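/- Let $X$ be a (real) Banach lattice whose norm dual $X^*$, a Banach lattice under the order $f\le g \iff f(x)\le g(x)$ for all $x\in X_+$, is order continuous. (A Banach lattice is order continuous if every net $x_\alpha\downarrow 0$ satisfies $\|x_\alpha\|\to 0$.) A net $(f_\alpha)$ in $X^*$ is called un-null if $\big\||f_\alpha|\wedge g\big\|\to 0$ for every $g\in X^*_+$; weak*-null if $f_\alpha(x)\to 0$ for every $x\in X$; and $|\sigma|(X^*,X)$-null if $|f_\alpha|(x)\to 0$ for every $x\in X_+$. Then the following are equivalent: \begin{enumerate} \item $X$ is order continuous; \item every norm bounded un-null net in $X^*$ is weak*-null; \item every norm bounded un-null net in $X^*$ is $|\sigma|(X^*,X)$-null; \item every norm bounded un-null sequence in $X^*$ is weak*-null; \item every norm bounded un-null sequence in $X^*$ is $|\sigma|(X^*,X)$-null. \end{enumerate} -/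

import Mathlib

open Filter Topology

universe u v

namespace BanachLattice

section Dual

/-! ### The dual of a Banach lattice

The norm dual `StrongDual ℝ X` (continuous linear functionals with the operator norm) is ordered by
`f ≤ g` iff `f x ≤ g x` for all `x ≥ 0`. Its lattice operations are given by the Riesz–Kantorovich
formula `(f ⊔ g) x = sup {f y + g (x - y) | 0 ≤ y ≤ x}` for `x ≥ 0`. -/

variable {X : Type*} [NormedAddCommGroup X] [NormedSpace ℝ X] [Lattice X] [IsOrderedAddMonoid X]
  [IsOrderedModule ℝ X] [HasSolidNorm X]

instance dualPartialOrder : PartialOrder (StrongDual ℝ X) where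
  le f g := ∀ x : X, 0 ≤ x → f x ≤ g x
  le_refl _ _ _ := le_rfl
  le_trans _ _ _ hfg hgh x hx := (hfg x hx).trans (hgh x hx)
  le_antisymm f g hfg hgf := by
    have key : ∀ x : X, 0 ≤ x → f x = g x := fun x hx => le_antisymm (hfg x hx) (hgf x hx)
    ext x
    rw [← posPart_sub_negPart x, map_sub, map_sub, key _ (posPart_nonneg x),
      key _ (negPart_nonneg x)]

theorem dual_le_iff {f g : StrongDual ℝ X} : f ≤ g ↔ ∀ x : X, 0 ≤ x → f x ≤ g x := Iff.rfl

/-- The value `f⁺ x = sup {f y | 0 ≤ y ≤ x}` of the positive part of `f` at `x ≥ 0`. -/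
noncomputable def coneSup (f : StrongDual ℝ X) (x : X) : ℝ := sSup (f '' Set.Icc 0 x)

theorem apply_le_norm_of_mem (f : StrongDual ℝ X) {x y : X} (hy : |y| ≤ x) :
    f y ≤ ‖f‖ * ‖x‖ := by
  have hx : 0 ≤ x := (abs_nonneg y).trans hy
  calc f y ≤ ‖f y‖ := Real.le_norm_self _
    _ ≤ ‖f‖ * ‖y‖ := f.le_opNorm y
    _ ≤ ‖f‖ * ‖x‖ := by
      gcongr
      exact HasSolidNorm.solid (by rwa [abs_of_nonneg hx])

theorem coneSup_bddAbove (f : StrongDual ℝ X) (x : X) : BddAbove (f '' Set.Icc 0 x) := by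
  refine ⟨‖f‖ * ‖x‖, ?_⟩
  rintro _ ⟨y, hy, rfl⟩
  exact apply_le_norm_of_mem f (by rw [abs_of_nonneg hy.1]; exact hy.2)

theorem le_coneSup (f : StrongDual ℝ X) {x y : X} (h0 : 0 ≤ y) (h : y ≤ x) :
    f y ≤ coneSup f x :=
  le_csSup (coneSup_bddAbove f x) ⟨y, ⟨h0, h⟩, rfl⟩

theorem coneSup_le (f : StrongDual ℝ X) {x : X} (hx : 0 ≤ x) {c : ℝ}
    (h : ∀ y, 0 ≤ y → y ≤ x → f y ≤ c) : coneSup f x ≤ c := by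
  refine csSup_le ⟨f 0, 0, ⟨le_rfl, hx⟩, rfl⟩ ?_
  rintro _ ⟨y, hy, rfl⟩
  exact h y hy.1 hy.2

theorem coneSup_nonneg (f : StrongDual ℝ X) {x : X} (hx : 0 ≤ x) : 0 ≤ coneSup f x := by
  simpa using le_coneSup f le_rfl hx

theorem coneSup_add (f : StrongDual ℝ X) {x y : X} (hx : 0 ≤ x) (hy : 0 ≤ y) :
    coneSup f (x + y) = coneSup f x + coneSup f y := by
  apply le_antisymm
  · refine coneSup_le f (add_nonneg hx hy) fun z hz0 hz => ?_
    have h1 : f (z ⊓ x) ≤ coneSup f x := le_coneSup f (le_inf hz0 hx) inf_le_right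
    have h2 : f (z - z ⊓ x) ≤ coneSup f y := by
      refine le_coneSup f (sub_nonneg.2 inf_le_left) ?_
      rw [sub_le_comm]
      exact le_inf (sub_le_self _ hy) (sub_le_iff_le_add.2 hz)
    rw [map_sub] at h2
    linarith
  · rw [← le_sub_iff_add_le]
    refine coneSup_le f hx fun a ha0 ha => ?_
    rw [le_sub_comm]
    refine coneSup_le f hy fun b hb0 hb => ?_
    rw [le_sub_iff_add_le, ← map_add, add_comm]
    exact le_coneSup f (add_nonneg ha0 hb0) (add_le_add ha hb)

theorem coneSup_smul_le (f : StrongDual ℝ X) {c : ℝ} (hc : 0 < c) {x : X} (hx : 0 ≤ x) :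
    coneSup f (c • x) ≤ c * coneSup f x := by
  refine coneSup_le f (smul_nonneg hc.le hx) fun z hz0 hz => ?_
  have h := le_coneSup f (x := x) (smul_nonneg (inv_nonneg.2 hc.le) hz0) (by
    have := smul_le_smul_of_nonneg_left hz (inv_nonneg.2 hc.le)
    rwa [inv_smul_smul₀ hc.ne'] at this)
  rw [map_smul, smul_eq_mul] at h
  rwa [← inv_mul_le_iff₀ hc]

theorem coneSup_smul (f : StrongDual ℝ X) {c : ℝ} (hc : 0 ≤ c) {x : X} (hx : 0 ≤ x) :
    coneSup f (c • x) = c * coneSup f x := by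
  rcases hc.eq_or_lt with rfl | hc
  · simp [coneSup]
  · refine le_antisymm (coneSup_smul_le f hc hx) ?_
    have h := coneSup_smul_le f (inv_pos.2 hc) (smul_nonneg hc.le hx)
    rw [inv_smul_smul₀ hc.ne'] at h
    rwa [← le_inv_mul_iff₀ hc]

theorem coneSup_sub (f : StrongDual ℝ X) {x a b : X} (ha : 0 ≤ a) (hb : 0 ≤ b)
    (h : x = a - b) : coneSup f x⁺ - coneSup f x⁻ = coneSup f a - coneSup f b := by
  have e : x⁺ + b = a + x⁻ := by
    have := posPart_sub_negPart x
    rw [sub_eq_iff_eq_add] at this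
    rw [this, h]; abel
  have e' := congrArg (coneSup f) e
  rw [coneSup_add f (posPart_nonneg x) hb, coneSup_add f ha (negPart_nonneg x)] at e'
  linarith

/-- The positive part of a continuous functional: the linear extension of `coneSup f`. -/
noncomputable def dualPos (f : StrongDual ℝ X) : StrongDual ℝ X :=
  LinearMap.mkContinuous
    { toFun := fun x => coneSup f x⁺ - coneSup f x⁻
      map_add' := fun x y => by
        rw [coneSup_sub f (x := x + y) (add_nonneg (posPart_nonneg x) (posPart_nonneg y))
          (add_nonneg (negPart_nonneg x) (negPart_nonneg y)) (by
            nth_rw 1 [← posPart_sub_negPart x, ← posPart_sub_negPart y]; abel),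
          coneSup_add f (posPart_nonneg x) (posPart_nonneg y),
          coneSup_add f (negPart_nonneg x) (negPart_nonneg y)]
        ring
      map_smul' := fun c x => by
        simp only [RingHom.id_apply, smul_eq_mul]
        rcases le_total 0 c with hc | hc
        · rw [coneSup_sub f (x := c • x) (smul_nonneg hc (posPart_nonneg x))
            (smul_nonneg hc (negPart_nonneg x)) (by
              rw [← smul_sub, posPart_sub_negPart]),
            coneSup_smul f hc (posPart_nonneg x), coneSup_smul f hc (negPart_nonneg x)]
          ring
        · have hc' : 0 ≤ -c := neg_nonneg.2 hc
          rw [coneSup_sub f (x := c • x) (smul_nonneg hc' (negPart_nonneg x))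
            (smul_nonneg hc' (posPart_nonneg x)) (by
              rw [← smul_sub, ← neg_sub, posPart_sub_negPart, smul_neg, neg_smul, neg_neg]),
            coneSup_smul f hc' (posPart_nonneg x), coneSup_smul f hc' (negPart_nonneg x)]
          ring }
    ‖f‖ fun x => by
      have bound : ∀ y : X, 0 ≤ y → y ≤ |x| → coneSup f y ≤ ‖f‖ * ‖x‖ := fun y hy hyx =>
        coneSup_le f hy fun z hz0 hz => by
          rw [← norm_abs_eq_norm x]
          exact apply_le_norm_of_mem f (by rw [abs_of_nonneg hz0]; exact hz.trans hyx)
      have h1 := bound _ (posPart_nonneg x) (sup_le (le_abs_self x) (abs_nonneg x))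
      have h2 := bound _ (negPart_nonneg x) (sup_le (neg_le_abs x) (abs_nonneg x))
      have h3 := coneSup_nonneg f (posPart_nonneg x)
      have h4 := coneSup_nonneg f (negPart_nonneg x)
      change ‖coneSup f x⁺ - coneSup f x⁻‖ ≤ ‖f‖ * ‖x‖
      rw [Real.norm_eq_abs, abs_le]
      constructor <;> linarith

theorem dualPos_apply (f : StrongDual ℝ X) {x : X} (hx : 0 ≤ x) :
    dualPos f x = sSup (f '' Set.Icc 0 x) := by
  change coneSup f x⁺ - coneSup f x⁻ = coneSup f x
  rw [coneSup_sub f hx le_rfl (sub_zero x).symm]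
  simp [coneSup]

theorem le_dualPos (f : StrongDual ℝ X) : f ≤ dualPos f := fun x hx => by
  rw [dualPos_apply f hx]
  exact le_coneSup f hx le_rfl

theorem dualPos_nonneg (f : StrongDual ℝ X) : 0 ≤ dualPos f := fun x hx => by
  rw [dualPos_apply f hx]
  exact coneSup_nonneg f hx

theorem dualPos_le {f g : StrongDual ℝ X} (hfg : f ≤ g) (hg : 0 ≤ g) : dualPos f ≤ g :=
  fun x hx => by
    rw [dualPos_apply f hx]
    refine coneSup_le f hx fun y hy0 hy => (hfg y hy0).trans ?_
    have := hg (x - y) (sub_nonneg.2 hy)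
    rw [map_sub] at this
    simpa using this

instance dualIsOrderedAddMonoid : IsOrderedAddMonoid (StrongDual ℝ X) where
  add_le_add_left f g hfg h x hx := by
    simpa using hfg x hx

noncomputable instance dualLattice : Lattice (StrongDual ℝ X) where
  sup f g := g + dualPos (f - g)
  le_sup_left f g := sub_le_iff_le_add'.1 (le_dualPos (f - g))
  le_sup_right f g := le_add_of_nonneg_right (dualPos_nonneg (f - g))
  sup_le _ g _ hf hg :=
    le_sub_iff_add_le'.1 (dualPos_le (sub_le_sub_right hf g) (sub_nonneg.2 hg))
  inf f g := f - dualPos (f - g)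
  inf_le_left f g := sub_le_self f (dualPos_nonneg (f - g))
  inf_le_right f g := sub_le_comm.1 (le_dualPos (f - g))
  le_inf _ f _ hf hg :=
    le_sub_comm.1 (dualPos_le (sub_le_sub_left hg f) (sub_nonneg.2 hf))

instance dualIsOrderedModule : IsOrderedModule ℝ (StrongDual ℝ X) where
  smul_le_smul_of_nonneg_left c hc f g hfg x hx := by
    simpa using mul_le_mul_of_nonneg_left (hfg x hx) hc
  smul_le_smul_of_nonneg_right f hf c d hcd x hx := by
    simpa using mul_le_mul_of_nonneg_right hcd (by simpa using hf x hx)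

theorem dual_abs_apply_le (f : StrongDual ℝ X) {x : X} (hx : 0 ≤ x) :
    |f| x ≤ ‖f‖ * ‖x‖ := by
  change (-f + dualPos (f - -f)) x ≤ _
  rw [add_apply, dualPos_apply _ hx, ← le_sub_iff_add_le']
  refine coneSup_le _ hx fun y hy0 hy => ?_
  have h := apply_le_norm_of_mem f (x := x) (y := y - (x - y)) (by
    rw [abs_le']
    constructor
    · exact (sub_le_self _ (sub_nonneg.2 hy)).trans hy
    · rw [neg_sub]; exact (sub_le_self _ hy0).trans (sub_le_self _ hy0))
  simp only [map_sub, sub_apply, neg_apply] at h ⊢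
  linarith

theorem dual_apply_le_abs (f : StrongDual ℝ X) (x : X) : |f x| ≤ |f| |x| := by
  have key : ∀ y : X, 0 ≤ y → |f y| ≤ |f| y := fun y hy =>
    abs_le'.2 ⟨le_abs_self f y hy, neg_le_abs f y hy⟩
  calc |f x| = |f x⁺ - f x⁻| := by rw [← map_sub, posPart_sub_negPart]
    _ ≤ |f x⁺| + |f x⁻| := abs_sub _ _
    _ ≤ |f| x⁺ + |f| x⁻ := add_le_add (key _ (posPart_nonneg x)) (key _ (negPart_nonneg x))
    _ = |f| |x| := by rw [← map_add, posPart_add_negPart]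

instance dualHasSolidNorm : HasSolidNorm (StrongDual ℝ X) where
  solid f g hfg := by
    refine f.opNorm_le_bound (norm_nonneg g) fun x => ?_
    rw [← norm_abs_eq_norm x]
    exact (dual_apply_le_abs f x).trans
      ((hfg |x| (abs_nonneg x)).trans (dual_abs_apply_le g (abs_nonneg x)))

end Dual

section Convergence

/-! The following notions are stated for normed lattices. -/

variable (X : Type*) [NormedAddCommGroup X] [Lattice X] [IsOrderedAddMonoid X] [HasSolidNorm X]

/-- The norm of `X` is order continuous: every downward directed set (equivalently, every
decreasing net) with infimum `0` contains vectors of arbitrarily small norm; since the norm is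
monotone on positive vectors, this says that `x_α ↓ 0` implies `‖x_α‖ → 0`. -/
def IsOrderContinuous : Prop :=
  ∀ D : Set X, D.Nonempty → DirectedOn (fun x y => y ≤ x) D → IsGLB D 0 →
    ∀ ε : ℝ, 0 < ε → ∃ x ∈ D, ‖x‖ < ε

variable {X}

/-- The family `x` un-converges to `a` along the filter `l`: `‖|x i - a| ⊓ u‖ → 0` for every
`u ≥ 0`. -/
def UnTendsto {ι : Type*} (x : ι → X) (l : Filter ι) (a : X) : Prop :=
  ∀ u : X, 0 ≤ u → Tendsto (fun i => ‖|x i - a| ⊓ u‖) l (𝓝 0)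

end Convergence

section WeakStar

variable {X : Type*} [NormedAddCommGroup X] [NormedSpace ℝ X]

/-- The family `f` of functionals is weak*-null along the filter `l`. -/
def WeakStarNull {ι : Type*} (f : ι → StrongDual ℝ X) (l : Filter ι) : Prop :=
  Tendsto (fun i => StrongDual.toWeakDual (f i)) l (𝓝 0)

variable [Lattice X] [IsOrderedAddMonoid X] [IsOrderedModule ℝ X] [HasSolidNorm X]

/-- The family `f` of functionals is `|σ|(X*, X)`-null along the filter `l`: `|f i| x → 0` for
every `x ≥ 0`. -/
def AbsWeakStarNull {ι : Type*} (f : ι → StrongDual ℝ X) (l : Filter ι) : Prop :=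
  ∀ x : X, 0 ≤ x → Tendsto (fun i => |f i| x) l (𝓝 0)

end WeakStar

end BanachLattice

/-! The link between both sides is property (A), `DualBallAlmostOrderBounded`: for each `x ≥ 0`, the
positive dual unit ball lies below a single `g`, up to a remainder small at `x`. For complete `X`,
(A) is equivalent to order continuity of `X`. Given (A), `|f|` splits into `|f| ⊓ K • g`, small in
norm when `f` is un-null, and a remainder small at `x`; this yields all the convergence statements.

If (A) fails, greedy choice gives positive `f n` in the ball with `ε < (f n - 4 ^ n • S n)⁺ x`,
where `S n` is the sum of the earlier functionals. This sequence serves twice. If `X` is order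
continuous, evaluating at near-optimal points of `[0, x]` gives a contradiction. If `X*` is, the
functionals `(f n - 4 ^ n • S n)⁺` are almost disjoint, hence un-null, yet they are not weak*-null.
Both arguments rest on `IsOrderContinuous.exists_tendsto_tailSup`. -/

namespace BanachLattice

/-! ### Order continuous lattices: tail suprema and almost disjoint sequences -/

section OrderContinuous

variable {E : Type*} [NormedAddCommGroup E] [NormedSpace ℝ E] [Lattice E] [IsOrderedAddMonoid E]
  [IsOrderedModule ℝ E] [HasSolidNorm E]

theorem norm_le_norm_of_nonneg_of_le {a b : E} (ha : 0 ≤ a) (hab : a ≤ b) : ‖a‖ ≤ ‖b‖ :=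
  HasSolidNorm.solid (by rwa [abs_of_nonneg ha, abs_of_nonneg (ha.trans hab)])

/-- Normed lattices are Archimedean. -/
theorem eq_zero_of_forall_nsmul_le {w b : E} (hw : 0 ≤ w) (h : ∀ n : ℕ, n • w ≤ b) : w = 0 := by
  by_contra hne
  obtain ⟨n, hn⟩ := exists_nat_gt (‖b‖ / ‖w‖)
  have h1 := norm_le_norm_of_nonneg_of_le (nsmul_nonneg hw n) (h n)
  rw [← Nat.cast_smul_eq_nsmul ℝ, norm_smul, Real.norm_natCast] at h1
  rw [div_lt_iff₀ (norm_pos_iff.2 hne)] at hn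
  linarith

/-- In an order continuous normed lattice, order bounded monotone sequences are Cauchy. -/
theorem IsOrderContinuous.cauchySeq_of_monotone (hE : IsOrderContinuous E) {u : ℕ → E}
    (hu : Monotone u) {b : E} (hb : ∀ n, u n ≤ b) : CauchySeq u := by
  have key := hE {d | ∃ c, (∀ n, u n ≤ c) ∧ ∃ n, d = c - u n} ⟨b - u 0, b, hb, 0, rfl⟩ ?_ ?_
  · rw [Metric.cauchySeq_iff']
    intro ε hε
    obtain ⟨_, ⟨c, hc, N, rfl⟩, hN⟩ := key ε hε
    refine ⟨N, fun n hn => ?_⟩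
    rw [dist_eq_norm]
    exact (norm_le_norm_of_nonneg_of_le (sub_nonneg.2 (hu hn))
      (sub_le_sub_right (hc n) _)).trans_lt hN
  · rintro _ ⟨c, hc, n, rfl⟩ _ ⟨c', hc', n', rfl⟩
    exact ⟨c ⊓ c' - u (max n n'), ⟨_, fun k => le_inf (hc k) (hc' k), _, rfl⟩,
      sub_le_sub inf_le_left (hu (le_max_left _ _)),
      sub_le_sub inf_le_right (hu (le_max_right _ _))⟩
  · refine ⟨?_, fun w hw => ?_⟩
    · rintro _ ⟨c, hc, n, rfl⟩
      exact sub_nonneg.2 (hc n)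
    -- If `w` is a lower bound of the gaps, lowering an upper bound of `u` by `w⁺` leaves an upper
    -- bound. Iterating contradicts the Archimedean property unless `w⁺ = 0`.
    · have step : ∀ c, (∀ n, u n ≤ c) → ∀ n, u n ≤ c - w⁺ := fun c hc n => by
        rw [le_sub_comm]
        exact sup_le (hw ⟨c, hc, n, rfl⟩) (sub_nonneg.2 (hc n))
      have iter : ∀ k : ℕ, ∀ n, u n ≤ b - k • w⁺ := fun k => by
        induction k with
        | zero => simpa using hb
        | succ k ih => rw [succ_nsmul, ← sub_sub]; exact step _ ih
      have h0 : w⁺ = 0 := eq_zero_of_forall_nsmul_le (posPart_nonneg w)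
        fun k => le_sub_comm.1 (iter k 0)
      exact posPart_eq_zero.1 h0

theorem IsOrderContinuous.cauchySeq_of_antitone (hE : IsOrderContinuous E) {u : ℕ → E}
    (hu : Antitone u) {b : E} (hb : ∀ n, b ≤ u n) : CauchySeq u := by
  have h := hE.cauchySeq_of_monotone (u := fun n => -u n) (b := -b)
    (fun m n h => neg_le_neg (hu h)) fun n => neg_le_neg (hb n)
  have h' := h.neg
  rwa [show (-fun n => -u n) = u by ext n; simp] at h'

/-- In an order continuous Banach lattice, the tail suprema `t n = ⨆ k ≥ n, v k` of an order bounded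
sequence of positive vectors converge in norm, and subadditive functionals that are summable along
`v` are nonpositive at the limit. -/
theorem IsOrderContinuous.exists_tendsto_tailSup [CompleteSpace E] (hE : IsOrderContinuous E)
    {v : ℕ → E} (hv : ∀ n, 0 ≤ v n) {b : E} (hb : ∀ n, v n ≤ b) :
    ∃ (s : E) (t : ℕ → E), 0 ≤ s ∧ (∀ n, v n ≤ t n) ∧ Tendsto t atTop (𝓝 s) ∧
      ∀ p : E → ℝ, Continuous p → (∀ x y, 0 ≤ x → x ≤ y → p x ≤ p y) →
        (∀ x y, 0 ≤ x → 0 ≤ y → p (x ⊔ y) ≤ p x + p y) →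
        Summable (fun n => p (v n)) → p s ≤ 0 := by
  have hcau : ∀ n, ∃ a, Tendsto (partialSups fun k => v (k + n)) atTop (𝓝 a) := fun n =>
    cauchySeq_tendsto_of_complete (hE.cauchySeq_of_monotone (partialSups _).monotone
      fun m => partialSups_le _ _ _ fun k _ => hb (k + n))
  choose t ht using hcau
  have htop : ∀ n m, partialSups (fun k => v (k + n)) m ≤ t n := fun n m =>
    (partialSups _).monotone.ge_of_tendsto (ht n) m
  have hvt : ∀ n k, v (k + n) ≤ t n := fun n k =>
    (le_partialSups (fun k => v (k + n)) k).trans (htop n k)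
  have hv0 : ∀ n, v n ≤ t n := fun n => by simpa using hvt n 0
  have ht0 : ∀ n, 0 ≤ t n := fun n => (hv n).trans (hv0 n)
  have hanti : Antitone t := antitone_nat_of_succ_le fun n =>
    le_of_tendsto' (ht (n + 1)) fun m => partialSups_le _ _ _ fun k _ => by
      have := hvt n (k + 1)
      rwa [show k + 1 + n = k + (n + 1) by ring] at this
  obtain ⟨s, hs⟩ := cauchySeq_tendsto_of_complete (hE.cauchySeq_of_antitone hanti ht0)
  have hs0 : 0 ≤ s := ge_of_tendsto' hs ht0
  refine ⟨s, t, hs0, hv0, hs, fun p hp hmono hsup hsum => ?_⟩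
  have hp0 : 0 ≤ p 0 := by
    have := hsup 0 0 le_rfl le_rfl
    rw [sup_idem] at this
    linarith
  have hpv : ∀ n, 0 ≤ p (v n) := fun n => hp0.trans (hmono _ _ le_rfl (hv n))
  have hpart : ∀ n m, p (partialSups (fun k => v (k + n)) m) ≤
      ∑ k ∈ Finset.range (m + 1), p (v (k + n)) := fun n m => by
    induction m with
    | zero => simp
    | succ m ih =>
      rw [partialSups_add_one, Finset.sum_range_succ]
      have h0 : 0 ≤ partialSups (fun k => v (k + n)) m :=
        (hv (m + n)).trans (le_partialSups (fun k => v (k + n)) m)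
      exact (hsup _ _ h0 (hv _)).trans (add_le_add ih le_rfl)
  have htail : ∀ n, p s ≤ ∑' k, p (v (k + n)) := fun n =>
    (hmono _ _ hs0 (hanti.le_of_tendsto hs n)).trans <|
      le_of_tendsto' ((hp.tendsto _).comp (ht n)) fun m =>
        (hpart n m).trans (((summable_nat_add_iff n).2 hsum).sum_le_tsum _ fun k _ => hpv _)
  exact ge_of_tendsto' (tendsto_sum_nat_add fun n => p (v n)) htail

theorem sup_inf_le_add {a b c : E} (ha : 0 ≤ a) (hb : 0 ≤ b) (hc : 0 ≤ c) :
    (a ⊔ b) ⊓ c ≤ a ⊓ c + b ⊓ c := by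
  let _ : DistribLattice E := AddCommGroup.toDistribLattice E
  rw [inf_sup_right]
  exact sup_le (le_add_of_nonneg_right (le_inf hb hc)) (le_add_of_nonneg_left (le_inf ha hc))

/-- Scaling by `(c + 1)⁻¹` puts the infimum below both `d⁺` and `d⁻`, which are disjoint; `c + 1`
avoids treating `c = 0` and `c < 1` separately. -/
theorem smul_posPart_inf_negPart {d : E} {c : ℝ} (hc : 0 ≤ c) : c • d⁺ ⊓ d⁻ ≤ 0 := by
  have hc1 : 0 < c + 1 := by linarith
  have h : (c + 1)⁻¹ • (c • d⁺ ⊓ d⁻) ≤ d⁺ ⊓ d⁻ := by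
    refine le_inf ?_ ?_
    · rw [inv_smul_le_iff_of_pos hc1, add_smul, one_smul]
      exact inf_le_left.trans (le_add_of_nonneg_right (posPart_nonneg d))
    · rw [inv_smul_le_iff_of_pos hc1, add_smul, one_smul]
      exact inf_le_right.trans (le_add_of_nonneg_left (smul_nonneg hc (negPart_nonneg d)))
  rwa [posPart_inf_negPart_eq_zero, inv_smul_le_iff_of_pos hc1, smul_zero] at h

/-- With `d = f - c • g`, the difference of the two sides is below both `c • d⁺` and `d⁻`, which are
disjoint. For `‖f‖ ≤ 1` this bounds `‖d⁺ ⊓ g‖` by `c⁻¹`. -/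
theorem smul_posPart_sub_smul_inf_le {f g : E} (hf : 0 ≤ f) {c : ℝ} (hc : 0 ≤ c) :
    c • ((f - c • g)⁺ ⊓ g) ≤ f := by
  set d := f - c • g with hd
  have h1 : c • (d⁺ ⊓ g) ≤ c • d⁺ := smul_le_smul_of_nonneg_left inf_le_left hc
  have h2 : c • (d⁺ ⊓ g) ≤ c • g := smul_le_smul_of_nonneg_left inf_le_right hc
  have h3 : c • (d⁺ ⊓ g) - f ≤ d⁻ := by
    refine le_trans ?_ (neg_le_negPart d)
    rw [hd, neg_sub]
    exact sub_le_sub_right h2 f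
  have h4 := (le_inf ((sub_le_self _ hf).trans h1) h3).trans (smul_posPart_inf_negPart hc)
  exact sub_nonpos.1 h4

theorem posPart_sub_le {f g : E} (hf : 0 ≤ f) (hg : 0 ≤ g) : (f - g)⁺ ≤ f :=
  sup_le (sub_le_self f hg) hf

theorem summable_inv_four_pow : Summable fun n : ℕ => ((4 : ℝ) ^ n)⁻¹ := by
  simpa using summable_geometric_of_lt_one (r := (4 : ℝ)⁻¹) (by norm_num) (by norm_num)

/-- Removing from `f n` a large multiple of a bound `S n` of its predecessors leaves an almost
disjoint sequence, which is un-null if the lattice is order continuous. -/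
theorem IsOrderContinuous.unTendsto_posPart_sub [CompleteSpace E] (hE : IsOrderContinuous E)
    {f S : ℕ → E} (hf : ∀ n, 0 ≤ f n) (hf1 : ∀ n, ‖f n‖ ≤ 1) (hS : ∀ n, 0 ≤ S n)
    (hfS : ∀ i n, i < n → f i ≤ S n) :
    UnTendsto (fun n => (f n - (4 : ℝ) ^ n • S n)⁺) atTop 0 := by
  intro u hu
  set h : ℕ → E := fun n => (f n - (4 : ℝ) ^ n • S n)⁺ with hh
  have h0 : ∀ n, 0 ≤ h n := fun n => posPart_nonneg _
  have h4 : ∀ n : ℕ, (0 : ℝ) < 4 ^ n := fun n => by positivity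
  have hhf : ∀ n, h n ≤ f n := fun n =>
    posPart_sub_le (hf n) (smul_nonneg (h4 n).le (hS n))
  have hhS : ∀ n, ‖h n ⊓ S n‖ ≤ ((4 : ℝ) ^ n)⁻¹ := fun n => by
    have h1 := norm_le_norm_of_nonneg_of_le (smul_nonneg (h4 n).le (le_inf (h0 n) (hS n)))
      (smul_posPart_sub_smul_inf_le (g := S n) (hf n) (h4 n).le)
    rw [norm_smul, Real.norm_of_nonneg (h4 n).le] at h1
    rw [← one_div, le_div_iff₀' (h4 n)]
    exact h1.trans (hf1 n)
  have hv : ∀ n, 0 ≤ h n ⊓ u := fun n => le_inf (h0 n) hu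
  obtain ⟨s, t, hs, hvt, hts, hp⟩ := hE.exists_tendsto_tailSup hv fun n => inf_le_right
  have hinf : ∀ g : E, 0 ≤ g → Summable (fun n => ‖(h n ⊓ u) ⊓ g‖) → s ⊓ g = 0 := fun g hg hsum =>
    norm_le_zero_iff.1 <| hp (fun y => ‖y ⊓ g‖) (by fun_prop)
      (fun x y hx hxy => norm_le_norm_of_nonneg_of_le (le_inf hx hg) (inf_le_inf_right g hxy))
      (fun x y hx hy => (norm_le_norm_of_nonneg_of_le (le_inf (le_sup_of_le_left hx) hg)
        (sup_inf_le_add hx hy hg)).trans (norm_add_le _ _)) hsum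
  -- For `n > i`, `f i ≤ S n`, so the norms are dominated by the geometric bound `hhS`.
  have hsf : ∀ i, s ⊓ f i = 0 := fun i => by
    refine hinf (f i) (hf i) ((summable_nat_add_iff (i + 1)).1 ?_)
    refine Summable.of_nonneg_of_le (fun n => norm_nonneg _) (fun n => ?_)
      ((summable_nat_add_iff (i + 1)).2 summable_inv_four_pow)
    exact (norm_le_norm_of_nonneg_of_le (le_inf (hv _) (hf i))
      (inf_le_inf inf_le_left (hfS i _ (by omega)))).trans (hhS _)
  -- As `h n ≤ f n` is disjoint from `s`, taking `g = s` makes the series vanish, and `s` is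
  -- disjoint from itself.
  have hs_eq : s = 0 := by
    rw [← inf_idem s]
    refine hinf s hs ?_
    have hz : ∀ n, (h n ⊓ u) ⊓ s = 0 := fun n => by
      refine le_antisymm ?_ (le_inf (hv n) hs)
      rw [← hsf n]
      exact le_inf inf_le_right (inf_le_left.trans (inf_le_left.trans (hhf n)))
    simp only [hz, norm_zero]
    exact summable_zero
  rw [hs_eq] at hts
  refine squeeze_zero (fun n => norm_nonneg _) (fun n => ?_) (tendsto_norm_zero.comp hts)
  simp only [sub_zero, abs_of_nonneg (h0 n)]
  exact norm_le_norm_of_nonneg_of_le (hv n) (hvt n)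

end OrderContinuous

/-! ### Almost order boundedness of the dual ball -/

section DualBall

variable {X : Type*} [NormedAddCommGroup X] [NormedSpace ℝ X] [Lattice X] [IsOrderedAddMonoid X]
  [IsOrderedModule ℝ X] [HasSolidNorm X]

theorem dual_posPart_eq (f : StrongDual ℝ X) : f⁺ = dualPos f :=
  le_antisymm (sup_le (le_dualPos f) (dualPos_nonneg f))
    (dualPos_le (le_posPart f) (posPart_nonneg f))

theorem dual_apply_nonneg {f : StrongDual ℝ X} (hf : 0 ≤ f) {x : X} (hx : 0 ≤ x) : 0 ≤ f x := by
  simpa using hf x hx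

theorem dual_apply_mono {f : StrongDual ℝ X} (hf : 0 ≤ f) {x y : X} (hxy : x ≤ y) :
    f x ≤ f y := by
  have := dual_apply_nonneg hf (sub_nonneg.2 hxy)
  rwa [map_sub, sub_nonneg] at this

theorem dual_apply_le_norm {f : StrongDual ℝ X} {x : X} : f x ≤ ‖f‖ * ‖x‖ :=
  (Real.le_norm_self _).trans (f.le_opNorm x)

theorem exists_dual_nonneg_apply_eq_norm (x : X) (hx : 0 ≤ x) :
    ∃ f : StrongDual ℝ X, 0 ≤ f ∧ ‖f‖ ≤ 1 ∧ ‖x‖ ≤ f x := by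
  obtain ⟨f, hf, hfx⟩ := exists_dual_vector'' ℝ x
  refine ⟨|f|, abs_nonneg f, by rwa [norm_abs_eq_norm], ?_⟩
  have h := dual_apply_le_abs f x
  rw [abs_of_nonneg hx] at h
  exact (le_of_eq hfx.symm).trans ((le_abs_self _).trans h)

variable (X) in
/-- The dual unit ball is almost order bounded for the seminorms `f ↦ |f| x`, `x ≥ 0`. -/
def DualBallAlmostOrderBounded : Prop :=
  ∀ x : X, 0 ≤ x → ∀ ε : ℝ, 0 < ε → ∃ g : StrongDual ℝ X, 0 ≤ g ∧
    ∀ f : StrongDual ℝ X, 0 ≤ f → ‖f‖ ≤ 1 → (f - g)⁺ x ≤ ε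

theorem exists_seq_of_not_dualBallAlmostOrderBounded (h : ¬ DualBallAlmostOrderBounded X) :
    ∃ (x : X) (ε : ℝ) (f S : ℕ → StrongDual ℝ X), 0 ≤ x ∧ 0 < ε ∧ (∀ n, 0 ≤ f n) ∧
      (∀ n, ‖f n‖ ≤ 1) ∧ (∀ n, 0 ≤ S n) ∧ (∀ i n, i < n → f i ≤ S n) ∧
      ∀ n, ε < (f n - (4 : ℝ) ^ n • S n)⁺ x := by
  simp only [DualBallAlmostOrderBounded] at h
  push Not at h
  obtain ⟨x, hx, ε, hε, h⟩ := h
  choose! F hF0 hF1 hF using h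
  -- `F g` witnesses that `g` fails; apply it to `4 ^ n` times the sum of the functionals already
  -- chosen.
  let S : ℕ → StrongDual ℝ X := fun n => Nat.rec 0 (fun n s => s + F ((4 : ℝ) ^ n • s)) n
  have hSs : ∀ n, S (n + 1) = S n + F ((4 : ℝ) ^ n • S n) := fun n => rfl
  have h4 : ∀ n : ℕ, (0 : ℝ) ≤ 4 ^ n := fun n => by positivity
  have hS : ∀ n, 0 ≤ S n := fun n => by
    induction n with
    | zero => exact le_rfl
    | succ n ih => rw [hSs]; exact add_nonneg ih (hF0 _ (smul_nonneg (h4 n) ih))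
  have hg := fun n => smul_nonneg (h4 n) (hS n)
  have hmono : Monotone S := monotone_nat_of_le_succ fun n => by
    rw [hSs]; exact le_add_of_nonneg_right (hF0 _ (hg n))
  refine ⟨x, ε, fun n => F ((4 : ℝ) ^ n • S n), S, hx, hε, fun n => hF0 _ (hg n),
    fun n => hF1 _ (hg n), hS, fun i n hin => ?_, fun n => hF _ (hg n)⟩
  refine le_trans ?_ (hmono (Nat.succ_le_of_lt hin))
  rw [Nat.succ_eq_add_one, hSs]
  exact le_add_of_nonneg_left (hS i)

theorem IsOrderContinuous.dualBallAlmostOrderBounded [CompleteSpace X]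
    (hX : IsOrderContinuous X) : DualBallAlmostOrderBounded X := by
  by_contra hcon
  obtain ⟨x, ε, f, S, hx, hε, hf, hf1, hS, hfS, hlt⟩ :=
    exists_seq_of_not_dualBallAlmostOrderBounded hcon
  -- The Riesz–Kantorovich formula for the positive part. The points `y n` make each `f i` summable,
  -- so `f i s ≤ 0` at the limit `s` of their tail suprema `t n`, while `f n (t n) > ε`.
  have hy : ∀ n, ∃ y, 0 ≤ y ∧ y ≤ x ∧ ε < f n y - 4 ^ n * S n y := fun n => by
    by_contra! hle
    have := hlt n
    rw [dual_posPart_eq, dualPos_apply _ hx] at this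
    refine this.not_ge (coneSup_le _ hx fun y hy0 hyx => ?_)
    simpa using hle y hy0 hyx
  choose y hy0 hyx hy using hy
  have h4 : ∀ n : ℕ, (0 : ℝ) < 4 ^ n := fun n => by positivity
  have hSy : ∀ n, S n (y n) ≤ ‖x‖ * ((4 : ℝ) ^ n)⁻¹ := fun n => by
    rw [← div_eq_mul_inv, le_div_iff₀' (h4 n)]
    have h1 : f n (y n) ≤ ‖x‖ := (dual_apply_mono (hf n) (hyx n)).trans <|
      dual_apply_le_norm.trans (mul_le_of_le_one_left (norm_nonneg x) (hf1 n))
    linarith [hy n]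
  obtain ⟨s, t, hs, hyt, hts, hp⟩ := hX.exists_tendsto_tailSup hy0 hyx
  have hfs : ∀ i, f i s ≤ 0 := fun i => by
    refine hp (f i) (f i).continuous (fun a b _ hab => dual_apply_mono (hf i) hab)
      (fun a b ha hb => ?_) ((summable_nat_add_iff (i + 1)).1 ?_)
    · rw [← map_add]
      exact dual_apply_mono (hf i)
        (sup_le (le_add_of_nonneg_right hb) (le_add_of_nonneg_left ha))
    · refine Summable.of_nonneg_of_le (fun n => dual_apply_nonneg (hf i) (hy0 _)) (fun n => ?_)
        ((summable_nat_add_iff (i + 1)).2 (summable_inv_four_pow.mul_left ‖x‖))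
      exact (hfS i _ (by omega) _ (hy0 _)).trans (hSy _)
  have hlow : ∀ n, ε ≤ ‖t n - s‖ := fun n => by
    have h1 : f n (t n - s) ≤ ‖t n - s‖ :=
      dual_apply_le_norm.trans (mul_le_of_le_one_left (norm_nonneg _) (hf1 n))
    have h2 := dual_apply_mono (hf n) (hyt n)
    have h3 : 0 ≤ (4 : ℝ) ^ n * S n (y n) :=
      mul_nonneg (h4 n).le (dual_apply_nonneg (hS n) (hy0 n))
    rw [map_sub] at h1
    linarith [hy n, hfs n]
  exact hε.not_ge (ge_of_tendsto' (tendsto_iff_norm_sub_tendsto_zero.1 hts) hlow)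

/-- One functional `g` controls norms below a given `d ∈ D`: once `g` is nearly minimal on `D`,
further descent changes the norm little. A decreasing sequence in `D` is then Cauchy, and its limit
is a lower bound of `D`. -/
theorem DualBallAlmostOrderBounded.isOrderContinuous [CompleteSpace X]
    (hA : DualBallAlmostOrderBounded X) : IsOrderContinuous X := by
  intro D hD hdir hglb ε hε
  have hpos : ∀ d ∈ D, 0 ≤ d := fun d hd => hglb.1 hd
  have step : ∀ d ∈ D, ∀ δ : ℝ, 0 < δ → ∃ d' ∈ D, d' ≤ d ∧
      ∀ d'' ∈ D, d'' ≤ d' → ‖d' - d''‖ ≤ δ := by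
    intro d hd δ hδ
    obtain ⟨g, hg, hgA⟩ := hA d (hpos d hd) (δ / 2) (half_pos hδ)
    have hbdd : BddBelow (g '' D) := ⟨0, by
      rintro _ ⟨a, ha, rfl⟩
      exact dual_apply_nonneg hg (hpos a ha)⟩
    obtain ⟨_, ⟨a, ha, rfl⟩, hlt⟩ :=
      exists_lt_of_csInf_lt (hD.image g) (lt_add_of_pos_right (sInf (g '' D)) (half_pos hδ))
    obtain ⟨d', hd', hd'd, hd'a⟩ := hdir d hd a ha
    refine ⟨d', hd', hd'd, fun d'' hd'' hle => ?_⟩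
    -- Bound the norming `f` by `g + (f - g)⁺`: each term contributes at most `δ / 2`.
    obtain ⟨f, hf, hf1, hfn⟩ := exists_dual_nonneg_apply_eq_norm (d' - d'') (sub_nonneg.2 hle)
    have h1 := le_posPart (f - g) (d' - d'') (sub_nonneg.2 hle)
    have h2 := dual_apply_mono (posPart_nonneg (f - g))
      ((sub_le_self d' (hpos d'' hd'')).trans hd'd)
    have h3 := hgA f hf hf1
    have h4 := dual_apply_mono hg hd'a
    have h5 := csInf_le hbdd ⟨d'', hd'', rfl⟩
    rw [sub_apply, map_sub g] at h1
    linarith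
  choose! N hND hNle hN using step
  obtain ⟨d₀, hd₀⟩ := hD
  let δ : ℕ → ℝ := fun n => 1 / ((n : ℝ) + 1)
  have hδ : ∀ n, 0 < δ n := fun n => Nat.one_div_pos_of_nat
  let e : ℕ → X := fun n => Nat.rec (N d₀ (δ 0)) (fun n d => N d (δ (n + 1))) n
  have heD : ∀ n, e n ∈ D := fun n => by
    induction n with
    | zero => exact hND _ hd₀ _ (hδ 0)
    | succ n ih => exact hND _ ih _ (hδ (n + 1))
  have hanti : Antitone e := antitone_nat_of_succ_le fun n => hNle _ (heD n) _ (hδ (n + 1))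
  have heN : ∀ n, ∀ d ∈ D, d ≤ e n → ‖e n - d‖ ≤ δ n := fun n => by
    cases n with
    | zero => exact hN _ hd₀ _ (hδ 0)
    | succ n => exact hN _ (heD n) _ (hδ (n + 1))
  have hδ0 : Tendsto δ atTop (𝓝 0) := tendsto_one_div_add_atTop_nhds_zero_nat
  have hcau : CauchySeq e := by
    rw [Metric.cauchySeq_iff']
    intro η hη
    obtain ⟨n, hn⟩ := (hδ0.eventually (gt_mem_nhds hη)).exists
    refine ⟨n, fun m hm => ?_⟩
    rw [dist_comm, dist_eq_norm]
    exact (heN n _ (heD m) (hanti hm)).trans_lt hn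
  obtain ⟨a, ha⟩ := cauchySeq_tendsto_of_complete hcau
  have ha0 : 0 ≤ a := ge_of_tendsto' ha fun n => hpos _ (heD n)
  have hlow : a ≤ 0 := hglb.2 fun d hd => by
    have hbound : ∀ n, ‖(a - d)⁺‖ ≤ δ n := fun n => by
      -- A common lower bound `c ∈ D` of `d` and `e n` gives `(a - d)⁺ ≤ e n - c`.
      obtain ⟨c, hc, hcd, hcn⟩ := hdir d hd (e n) (heD n)
      refine (norm_le_norm_of_nonneg_of_le (posPart_nonneg _) ?_).trans (heN n c hc hcn)
      exact sup_le (sub_le_sub (hanti.le_of_tendsto ha n) hcd) (sub_nonneg.2 hcn)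
    have := norm_le_zero_iff.1 (ge_of_tendsto' hδ0 hbound)
    exact sub_nonpos.1 (posPart_eq_zero.1 this)
  rw [le_antisymm hlow ha0] at ha
  obtain ⟨n, hn⟩ := ((tendsto_norm_zero.comp ha).eventually (gt_mem_nhds hε)).exists
  exact ⟨e n, heD n, hn⟩

/-- Norm bounded un-null families are `|σ|(X*, X)`-null if the dual ball is almost order bounded. -/
theorem DualBallAlmostOrderBounded.absWeakStarNull (hA : DualBallAlmostOrderBounded X) {ι : Type*}
    {l : Filter ι} {f : ι → StrongDual ℝ X} (hb : ∃ C : ℝ, ∀ i, ‖f i‖ ≤ C)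
    (hf : UnTendsto f l 0) : AbsWeakStarNull f l := by
  intro x hx
  obtain ⟨C, hC⟩ := hb
  -- The maximum with `1` keeps `K` positive, so that `f i` can be scaled into the unit ball.
  set K : ℝ := max C 1
  have hK : 0 < K := lt_max_of_lt_right one_pos
  rw [Metric.tendsto_nhds]
  intro ε hε
  obtain ⟨g, hg, hgA⟩ := hA x hx (ε / (2 * K)) (by positivity)
  have hKg : 0 ≤ K • g := smul_nonneg hK.le hg
  have hlim : Tendsto (fun i => ‖|f i - 0| ⊓ K • g‖ * ‖x‖) l (𝓝 0) := by
    simpa using (hf _ hKg).mul_const ‖x‖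
  filter_upwards [hlim.eventually (gt_mem_nhds (half_pos hε))] with i hi
  rw [sub_zero] at hi
  have h0 := dual_apply_nonneg (abs_nonneg (f i)) hx
  rw [Real.dist_eq, sub_zero, abs_of_nonneg h0]
  have h1 : (K⁻¹ • |f i| - g)⁺ x ≤ ε / (2 * K) := by
    refine hgA _ (smul_nonneg (inv_nonneg.2 hK.le) (abs_nonneg _)) ?_
    rw [norm_smul, norm_abs_eq_norm, norm_inv, Real.norm_of_nonneg hK.le, inv_mul_le_iff₀ hK,
      mul_one]
    exact (hC i).trans (le_max_left _ _)
  have h2 : |f i| ≤ |f i| ⊓ K • g + K • (K⁻¹ • |f i| - g)⁺ := by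
    rw [← sub_le_iff_le_add]
    refine le_inf (sub_le_self _ (smul_nonneg hK.le (posPart_nonneg _))) ?_
    rw [sub_le_comm]
    have := smul_le_smul_of_nonneg_left (le_posPart (K⁻¹ • |f i| - g)) hK.le
    rwa [smul_sub, smul_inv_smul₀ hK.ne'] at this
  have h3 := h2 x hx
  have h4 := dual_apply_le_norm (f := |f i| ⊓ K • g) (x := x)
  rw [add_apply, smul_apply, smul_eq_mul] at h3
  have h5 : K * (K⁻¹ • |f i| - g)⁺ x ≤ ε / 2 :=
    (mul_le_mul_of_nonneg_left h1 hK.le).trans_eq (by field_simp)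
  linarith

theorem weakStarNull_iff {ι : Type*} {l : Filter ι} {f : ι → StrongDual ℝ X} :
    WeakStarNull f l ↔ ∀ x, Tendsto (fun i => f i x) l (𝓝 0) :=
  tendsto_iff_forall_eval_tendsto_topDualPairing

theorem AbsWeakStarNull.weakStarNull {ι : Type*} {l : Filter ι} {f : ι → StrongDual ℝ X}
    (hf : AbsWeakStarNull f l) : WeakStarNull f l :=
  weakStarNull_iff.2 fun x =>
    squeeze_zero_norm (fun i => dual_apply_le_abs (f i) x) (hf |x| (abs_nonneg x))

/-- If norm bounded un-null sequences are weak*-null and the dual is order continuous, then the dual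
ball is almost order bounded. -/
theorem dualBallAlmostOrderBounded_of_forall_seq (hX' : IsOrderContinuous (StrongDual ℝ X))
    (h : ∀ f : ℕ → StrongDual ℝ X, (∃ C : ℝ, ∀ n, ‖f n‖ ≤ C) → UnTendsto f atTop 0 →
      WeakStarNull f atTop) : DualBallAlmostOrderBounded X := by
  by_contra hcon
  obtain ⟨x, ε, f, S, hx, hε, hf, hf1, hS, hfS, hlt⟩ :=
    exists_seq_of_not_dualBallAlmostOrderBounded hcon
  have hnull := h _ ⟨1, fun n => ?_⟩ (hX'.unTendsto_posPart_sub hf hf1 hS hfS)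
  · exact hε.not_ge (ge_of_tendsto' (weakStarNull_iff.1 hnull x) fun n => (hlt n).le)
  · exact (norm_le_norm_of_nonneg_of_le (posPart_nonneg _)
      (posPart_sub_le (hf n) (smul_nonneg (by positivity) (hS n)))).trans (hf1 n)

end DualBall

end BanachLattice

theorem mainTheorem10 (X : Type u) [NormedAddCommGroup X] [NormedSpace ℝ X]
    [CompleteSpace X] [Lattice X] [IsOrderedAddMonoid X] [IsOrderedModule ℝ X] [HasSolidNorm X]
    (hX' : BanachLattice.IsOrderContinuous (StrongDual ℝ X)) :
    List.TFAE [
      BanachLattice.IsOrderContinuous X,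
      ∀ (ι : Type v) [Nonempty ι] [Preorder ι] [IsDirectedOrder ι] (f : ι → StrongDual ℝ X),
        (∃ C : ℝ, ∀ i, ‖f i‖ ≤ C) → BanachLattice.UnTendsto f Filter.atTop 0 →
          BanachLattice.WeakStarNull f Filter.atTop,
      ∀ (ι : Type v) [Nonempty ι] [Preorder ι] [IsDirectedOrder ι] (f : ι → StrongDual ℝ X),
        (∃ C : ℝ, ∀ i, ‖f i‖ ≤ C) → BanachLattice.UnTendsto f Filter.atTop 0 →
          BanachLattice.AbsWeakStarNull f Filter.atTop,
      ∀ f : ℕ → StrongDual ℝ X,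
        (∃ C : ℝ, ∀ n, ‖f n‖ ≤ C) → BanachLattice.UnTendsto f Filter.atTop 0 →
          BanachLattice.WeakStarNull f Filter.atTop,
      ∀ f : ℕ → StrongDual ℝ X,
        (∃ C : ℝ, ∀ n, ‖f n‖ ≤ C) → BanachLattice.UnTendsto f Filter.atTop 0 →
          BanachLattice.AbsWeakStarNull f Filter.atTop] := by
  tfae_have 1 → 3 := fun h ι _ _ _ f hb hf => h.dualBallAlmostOrderBounded.absWeakStarNull hb hf
  tfae_have 3 → 2 := fun h ι _ _ _ f hb hf => (h ι f hb hf).weakStarNull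
  tfae_have 1 → 5 := fun h f hb hf => h.dualBallAlmostOrderBounded.absWeakStarNull hb hf
  tfae_have 5 → 4 := fun h f hb hf => (h f hb hf).weakStarNull
  tfae_have 4 → 1 := fun h =>
    (BanachLattice.dualBallAlmostOrderBounded_of_forall_seq hX' h).isOrderContinuous
  tfae_have 2 → 4 := by
    intro h f hb hf
    -- Nets are indexed in universe `v`, so the sequence is viewed as a net over a lifted copy of
    -- `ℕ`.
    have hdir : IsDirectedOrder (ULift.{v} ℕ) :=
      ⟨fun a b => ⟨⟨max a.down b.down⟩, le_max_left a.down b.down, le_max_right a.down b.down⟩⟩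
    have hdown : Tendsto (ULift.down : ULift.{v} ℕ → ℕ) atTop atTop :=
      tendsto_atTop.2 fun n => (eventually_ge_atTop (ULift.up n)).mono fun a ha => ha
    have hup : Tendsto (ULift.up : ℕ → ULift.{v} ℕ) atTop atTop :=
      tendsto_atTop.2 fun n => (eventually_ge_atTop n.down).mono fun a ha => ha
    have hlim := h (ULift.{v} ℕ) (fun n => f n.down) (hb.imp fun C hC n => hC n.down)
      fun u hu => (hf u hu).comp hdown
    exact hlim.comp hup
  tfae_finish
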